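/- Let $n\ge 1$ and let $I_{[n]}$ be the set of functions $\mathbf i:\{1,\dots,n\}\to\{0,1\}$; write $\bar{\mathbf i}(k)=1-\mathbf i(k)$. Identify $M_2(\mathbb C)^{\otimes n}$ with the complex matrices indexed by $I_{[n]}\times I_{[n]}$. Let $\mathcal V_n^+$ be the set of functions $I_{[n]}\to[0,\infty)$ and $\mathcal V_n^{\rm sa}$ the set of functions $u:I_{[n]}\to\mathbb C$ with $u_{\bar{\mathbf i}}=\overline{u_{\mathbf i}}$ for all $\mathbf i$. For $a\in\mathcal V_n^+$ and $c\in\mathcal V_n^{\rm sa}$ let $X(a,c)$ be the matrix with $(\mathbf i,\mathbf i)$ entry $a_{\mathbf i}$, $(\mathbf i,\bar{\mathbf i})$ entry $c_{\mathbf i}$ and all other entries $0$. The X-part of a matrix is obtained by replacing all entries outside the positions $(\mathbf i,\mathbf i)$ and $(\mathbf i,\bar{\mathbf i})$ by $0$. With $z^{\mathbf i}=\prod_{k=1}^n z_k^{1-2\mathbf i(k)}$ and $\langle x,y\rangle=\sum_{\mathbf i\in I_{[n]}}x_{\mathbf i}y_{\mathbf i}$, put $$\delta_n(s)=\inf_{r\in(0,\infty)^n}\sum_{\mathbf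 i\in I_{[n]}}s_{\mathbf i}r^{\mathbf i},\qquad \|u\|_{X_n}=\sup_{\alpha\in\mathbb T^n}\sum_{\mathbf i\in I_{[n]}}u_{\mathbf i}\alpha^{\mathbf i}\qquad (s\in\mathcal V_n^+,\ u\in\mathcal V_n^{\rm sa}),$$ where $\mathbb T$ is the complex unit circle, and $$\Delta_n(a)=\inf\{\langle s,a\rangle: s\in\mathcal V_n^+,\ \delta_n(s)=1\},\qquad \|c\|'_{X_n}=\sup\{\langle u,c\rangle: u\in\mathcal V_n^{\rm sa},\ \|u\|_{X_n}=1\}.$$ A state is a positive semidefinite matrix in $M_2(\mathbb C)^{\otimes n}$ (not necessarily of trace one), and it is separable if it is a finite sum of nonnegative multiples of pure product states $|\xi\rangle\langle\xi|$, $\xi=x_1\otimes\cdots\otimes x_n$ with unit vectors $x_k\in\mathbb C^2$. Let $\varrho$ be an $n$-qubit state with X-part $X(a,c)$, where $a\in\mathcal V_n^+$ and $c\in\mathcal V_n^{\rm sa}$. If $\varrho$ is separable, then $$\Delta_n(a)\ge\|c\|'_{X_n}.$$ -/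

import Mathlib

namespace MultiQubit

open scoped ComplexOrder

/-- `n`-bit indices. -/
abbrev Index (n : ℕ) : Type := Fin n → Fin 2

/-- The index obtained by switching every digit (addition in `Fin 2` is modulo 2). -/
def Index.flip {n : ℕ} (i : Index n) : Index n := fun k => i k + 1

/-- `n`-qubit matrices: `M₂ ⊗ ⋯ ⊗ M₂` written entrywise over the `n`-bit indices. -/
abbrev QMatrix (n : ℕ) : Type := Matrix (Index n) (Index n) ℂ

/-- Nonnegative real functions on the indices. -/
def VPos (n : ℕ) : Set (Index n → ℝ) := {s | ∀ i, 0 ≤ s i}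

/-- Complex functions on the indices with `u (flip i) = conj (u i)`. -/
def VSa (n : ℕ) : Set (Index n → ℂ) := {u | ∀ i, u i.flip = star (u i)}

/-- The X-shaped matrix with diagonal `s` and anti-diagonal `u`. -/
def X {n : ℕ} (s : Index n → ℝ) (u : Index n → ℂ) : QMatrix n :=
  Matrix.of fun i j => if j = i then (s i : ℂ) else if j = i.flip then u i else 0

/-- The X-part of a matrix: all entries off the diagonal and the anti-diagonal are replaced
by zero. -/
def xPart {n : ℕ} (ρ : QMatrix n) : QMatrix n :=
  Matrix.of fun i j => if j = i ∨ j = i.flip then ρ i j else 0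

/-- The product vector `x₁ ⊗ ⋯ ⊗ xₙ`. -/
def productVector {n : ℕ} (x : Fin n → EuclideanSpace ℂ (Fin 2)) : Index n → ℂ :=
  fun i => ∏ k, x k (i k)

/-- The rank one matrix `|ξ⟩⟨ξ|` of the product vector `ξ = x₁ ⊗ ⋯ ⊗ xₙ`. -/
def productState {n : ℕ} (x : Fin n → EuclideanSpace ℂ (Fin 2)) : QMatrix n :=
  Matrix.vecMulVec (productVector x) (star (productVector x))

/-- An (unnormalized) state: a positive semidefinite matrix, of any trace. -/
def IsState {n : ℕ} (ρ : QMatrix n) : Prop := ρ.PosSemidef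

/-- (Full) separability: a finite sum of nonnegative multiples of pure product states given by
unit vectors. If the trace is one then the weights sum to one, so this is a convex combination. -/
def IsSeparable {n : ℕ} (ρ : QMatrix n) : Prop :=
  ∃ (m : ℕ) (p : Fin m → ℝ) (x : Fin m → Fin n → EuclideanSpace ℂ (Fin 2)),
    (∀ j, 0 ≤ p j) ∧ (∀ j k, ‖x j k‖ = 1) ∧ ρ = ∑ j, (p j : ℂ) • productState (x j)

/-- The monomial `z^i = ∏ₖ zₖ ^ (1 - 2 i(k))`. -/
def mono {K : Type*} [Field K] {n : ℕ} (z : Fin n → K) (i : Index n) : K :=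
  ∏ k, z k ^ (1 - 2 * ((i k : ℕ) : ℤ))

/-- `δₙ(s) = inf_{r ∈ (0,∞)ⁿ} ∑ᵢ sᵢ r^i`. -/
noncomputable def delta {n : ℕ} (s : Index n → ℝ) : ℝ :=
  sInf {t | ∃ r : Fin n → ℝ, (∀ k, 0 < r k) ∧ t = ∑ i, s i * mono r i}

/-- `‖u‖_{Xₙ} = sup_{α ∈ 𝕋ⁿ} ∑ᵢ uᵢ α^i`. For `u ∈ VSa n` the sum is real, being invariant under
conjugation. -/
noncomputable def xNorm {n : ℕ} (u : Index n → ℂ) : ℝ :=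
  sSup {t | ∃ α : Fin n → ℂ, (∀ k, ‖α k‖ = 1) ∧ t = (∑ i, u i * mono α i).re}

/-- `Δₙ(a) = inf {⟨s, a⟩ : s ∈ Vₙ⁺, δₙ(s) = 1}`. -/
noncomputable def Delta {n : ℕ} (a : Index n → ℝ) : ℝ :=
  sInf {t | ∃ s ∈ VPos n, delta s = 1 ∧ t = ∑ i, s i * a i}

/-- The dual norm `‖c‖'_{Xₙ} = sup {⟨u, c⟩ : u ∈ Vₙ^sa, ‖u‖_{Xₙ} = 1}` for the bilinear pairing,
which is real for `u, c ∈ VSa n`. -/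
noncomputable def xDualNorm {n : ℕ} (c : Index n → ℂ) : ℝ :=
  sSup {t | ∃ u ∈ VSa n, xNorm u = 1 ∧ t = (∑ i, u i * c i).re}

end MultiQubit

namespace MultiQubit

open scoped ComplexOrder

/-! For `δ(s) = ‖u‖ = 1`, pairing with `X(s, -u)` acts as an entanglement witness. If no coordinate
of a product vector vanishes, its moduli and phases separate: the diagonal is `R r^i` and the
anti-diagonal is `R α^i`, with the same `R > 0`, all `r k > 0` and all `α k` unimodular
(`prod_norm_sq_eq`, `productState_flip`). Hence `Re ∑ u α^i ≤ ‖u‖ ≤ δ(s) ≤ ∑ s r^i`. Summing over a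
separable decomposition gives `⟨u, c⟩ ≤ ⟨s, a⟩`; then take the supremum over `u` and the infimum
over `s`. -/

lemma Index.flip_ne {n : ℕ} (hn : 1 ≤ n) (i : Index n) : i.flip ≠ i := by
  intro h
  have h0 := congrFun h ⟨0, hn⟩
  simp only [Index.flip] at h0
  generalize i ⟨0, hn⟩ = b at h0
  fin_cases b <;> simp at h0

lemma mono_pos {n : ℕ} {r : Fin n → ℝ} (hr : ∀ k, 0 < r k) (i : Index n) : 0 < mono r i :=
  Finset.prod_pos fun k _ => zpow_pos (hr k) _

lemma norm_mono {n : ℕ} {α : Fin n → ℂ} (hα : ∀ k, ‖α k‖ = 1) (i : Index n) :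
    ‖mono α i‖ = 1 := by
  simp [mono, norm_prod, norm_zpow, hα]

lemma sum_mono {n : ℕ} (r : Fin n → ℝ) : ∑ i, mono r i = ∏ k, (r k + (r k)⁻¹) := by
  have h := Finset.prod_univ_sum (fun _ : Fin n => (Finset.univ : Finset (Fin 2)))
    (fun k b => r k ^ (1 - 2 * ((b : ℕ) : ℤ)))
  simp only [Fintype.piFinset_univ] at h
  simp only [mono]
  rw [← h]
  refine Finset.prod_congr rfl fun k _ => ?_
  simp [Fin.sum_univ_two]

lemma delta_le {n : ℕ} {s : Index n → ℝ} (hs : s ∈ VPos n) {r : Fin n → ℝ}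
    (hr : ∀ k, 0 < r k) : delta s ≤ ∑ i, s i * mono r i := by
  refine csInf_le ⟨0, ?_⟩ ⟨r, hr, rfl⟩
  rintro t ⟨r', hr', rfl⟩
  exact Finset.sum_nonneg fun i _ => mul_nonneg (hs i) (mono_pos hr' i).le

lemma le_xNorm {n : ℕ} (u : Index n → ℂ) {α : Fin n → ℂ} (hα : ∀ k, ‖α k‖ = 1) :
    (∑ i, u i * mono α i).re ≤ xNorm u := by
  refine le_csSup ⟨∑ i, ‖u i‖, ?_⟩ ⟨α, hα, rfl⟩
  rintro t ⟨β, hβ, rfl⟩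
  refine (Complex.re_le_norm _).trans ((norm_sum_le _ _).trans_eq ?_)
  simp [norm_mono hβ]

/-- The constant function `2⁻ⁿ` is normalized for `δₙ`, by `t + t⁻¹ ≥ 2`. -/
lemma delta_const (n : ℕ) : delta (fun _ : Index n => ((2 : ℝ) ^ n)⁻¹) = 1 := by
  have key : ∀ r : Fin n → ℝ, ∑ i, ((2 : ℝ) ^ n)⁻¹ * mono r i =
      ((2 : ℝ) ^ n)⁻¹ * ∏ k, (r k + (r k)⁻¹) := fun r => by
    rw [← Finset.mul_sum, sum_mono]
  have h2 : (0 : ℝ) < 2 ^ n := by positivity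
  refine IsLeast.csInf_eq ⟨⟨fun _ => 1, fun _ => one_pos, ?_⟩, ?_⟩
  · rw [key]
    norm_num
  · rintro t ⟨r, hr, rfl⟩
    rw [key, inv_mul_eq_div, le_div_iff₀ h2, one_mul]
    calc (2 : ℝ) ^ n = ∏ _k : Fin n, (2 : ℝ) := by simp
      _ ≤ _ := Finset.prod_le_prod (fun _ _ => zero_le_two) fun k _ => by
        have h := hr k
        have e : r k + (r k)⁻¹ - 2 = (r k - 1) ^ 2 / r k := by field_simp; ring
        have : 0 ≤ (r k - 1) ^ 2 / r k := by positivity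
        linarith

lemma productState_apply {n : ℕ} (x : Fin n → EuclideanSpace ℂ (Fin 2)) (i j : Index n) :
    productState x i j = ∏ k, x k (i k) * star (x k (j k)) := by
  simp [productState, productVector, Matrix.vecMulVec_apply, Finset.prod_mul_distrib]

lemma productState_diag {n : ℕ} (x : Fin n → EuclideanSpace ℂ (Fin 2)) (i : Index n) :
    productState x i i = ((∏ k, ‖x k (i k)‖ ^ 2 : ℝ) : ℂ) := by
  rw [productState_apply]
  push_cast
  exact Finset.prod_congr rfl fun k _ => Complex.mul_conj' _

lemma prod_norm_sq_eq {n : ℕ} {x : Fin n → EuclideanSpace ℂ (Fin 2)}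
    (hx : ∀ k b, x k b ≠ 0) (i : Index n) :
    ∏ k, ‖x k (i k)‖ ^ 2 =
      (∏ k, ‖x k 0‖ * ‖x k 1‖) * mono (fun k => ‖x k 0‖ / ‖x k 1‖) i := by
  rw [mono, ← Finset.prod_mul_distrib]
  refine Finset.prod_congr rfl fun k _ => ?_
  have h0 := norm_ne_zero_iff.2 (hx k 0)
  have h1 := norm_ne_zero_iff.2 (hx k 1)
  generalize i k = b
  fin_cases b
  · simp; field_simp
  · simp; field_simp

/-- Digit 0 contributes `x₀ x̄₁`, digit 1 its conjugate; for the unimodular phase conjugation is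
inversion, matching the exponents `±1` of `mono`. -/
lemma productState_flip {n : ℕ} {x : Fin n → EuclideanSpace ℂ (Fin 2)}
    (hx : ∀ k b, x k b ≠ 0) (i : Index n) :
    productState x i i.flip = ((∏ k, ‖x k 0‖ * ‖x k 1‖ : ℝ) : ℂ) *
      mono (fun k => x k 0 * star (x k 1) / (‖x k 0‖ * ‖x k 1‖ : ℂ)) i := by
  rw [productState_apply, mono, Complex.ofReal_prod, ← Finset.prod_mul_distrib]
  refine Finset.prod_congr rfl fun k _ => ?_
  have h0 : (‖x k 0‖ : ℂ) ≠ 0 := by simpa using hx k 0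
  have h1 : (‖x k 1‖ : ℂ) ≠ 0 := by simpa using hx k 1
  have e0 := Complex.mul_conj' (x k 0)
  have e1 := Complex.mul_conj' (x k 1)
  have s1 : (starRingEnd ℂ) (x k 1) ≠ 0 := by simpa using hx k 1
  have n0 := hx k 0
  simp only [Index.flip]
  generalize i k = b
  fin_cases b
  · simp; field_simp
  · simp
    field_simp
    linear_combination (x k 1 * (starRingEnd ℂ) (x k 1)) * e0 + (‖x k 0‖ : ℂ) ^ 2 * e1

/-- The `k`-th factor always involves both coordinates of `x k`, whatever the digit. -/
lemma productState_flip_eq_zero {n : ℕ} {x : Fin n → EuclideanSpace ℂ (Fin 2)} {k : Fin n}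
    {b : Fin 2} (hx : x k b = 0) (i : Index n) : productState x i i.flip = 0 := by
  rw [productState_apply]
  refine Finset.prod_eq_zero (Finset.mem_univ k) ?_
  simp only [Index.flip]
  generalize i k = d
  fin_cases b <;> fin_cases d <;> simp_all

/-- The witness `X(s, -u)` with `‖u‖ ≤ δ(s)` is nonnegative on product vectors. -/
lemma re_sum_flip_le_sum_diag {n : ℕ} (x : Fin n → EuclideanSpace ℂ (Fin 2))
    {s : Index n → ℝ} (hs : s ∈ VPos n) {u : Index n → ℂ} (hsu : xNorm u ≤ delta s) :
    (∑ i, u i * productState x i i.flip).re ≤ ∑ i, s i * ∏ k, ‖x k (i k)‖ ^ 2 := by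
  by_cases hx : ∀ k b, x k b ≠ 0
  · have hR : 0 ≤ ∏ k, ‖x k 0‖ * ‖x k 1‖ := Finset.prod_nonneg fun k _ => by positivity
    have h0 : ∀ k b, 0 < ‖x k b‖ := fun k b => norm_pos_iff.2 (hx k b)
    set α : Fin n → ℂ := fun k => x k 0 * star (x k 1) / (‖x k 0‖ * ‖x k 1‖ : ℂ) with hα
    have hα1 : ∀ k, ‖α k‖ = 1 := fun k => by
      simp only [hα, norm_div, norm_mul, norm_star, Complex.norm_real, norm_norm]
      exact div_self (mul_pos (h0 k 0) (h0 k 1)).ne'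
    have hl := le_xNorm u hα1
    have hr := delta_le hs (r := fun k => ‖x k 0‖ / ‖x k 1‖) fun k => div_pos (h0 k 0) (h0 k 1)
    calc (∑ i, u i * productState x i i.flip).re
        = (∏ k, ‖x k 0‖ * ‖x k 1‖) * (∑ i, u i * mono α i).re := by
          rw [← Complex.re_ofReal_mul, Finset.mul_sum]
          congr 1
          refine Finset.sum_congr rfl fun i _ => ?_
          rw [productState_flip hx]
          ring
      _ ≤ (∏ k, ‖x k 0‖ * ‖x k 1‖) *
            ∑ i, s i * mono (fun k => ‖x k 0‖ / ‖x k 1‖) i :=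
          mul_le_mul_of_nonneg_left (hl.trans (hsu.trans hr)) hR
      _ = _ := by
          rw [Finset.mul_sum]
          refine Finset.sum_congr rfl fun i _ => ?_
          rw [prod_norm_sq_eq hx]
          ring
  -- A vanishing coordinate leaves no ratio or phase to use, but kills the whole anti-diagonal.
  · push Not at hx
    obtain ⟨k, b, hx⟩ := hx
    simp only [productState_flip_eq_zero hx, mul_zero, Finset.sum_const_zero, Complex.zero_re]
    exact Finset.sum_nonneg fun i _ =>
      mul_nonneg (hs i) (Finset.prod_nonneg fun k _ => by positivity)

lemma IsSeparable.re_pairing_le {n : ℕ} {ρ : QMatrix n} (hρ : IsSeparable ρ)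
    {s : Index n → ℝ} (hs : s ∈ VPos n) {u : Index n → ℂ} (hsu : xNorm u ≤ delta s) :
    (∑ i, u i * ρ i i.flip).re ≤ ∑ i, s i * (ρ i i).re := by
  obtain ⟨m, p, x, hp, -, rfl⟩ := hρ
  calc (∑ i, u i * (∑ j, (p j : ℂ) • productState (x j)) i i.flip).re
      = ∑ j, p j * (∑ i, u i * productState (x j) i i.flip).re := by
        simp only [← Complex.re_ofReal_mul, ← Complex.re_sum]
        congr 1
        simp only [Matrix.sum_apply, Matrix.smul_apply, smul_eq_mul, Finset.mul_sum]
        rw [Finset.sum_comm]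
        exact Finset.sum_congr rfl fun j _ => Finset.sum_congr rfl fun i _ => by ring
    _ ≤ ∑ j, p j * ∑ i, s i * ∏ k, ‖x j k (i k)‖ ^ 2 :=
        Finset.sum_le_sum fun j _ =>
          mul_le_mul_of_nonneg_left (re_sum_flip_le_sum_diag (x j) hs hsu) (hp j)
    _ = _ := by
        simp only [Matrix.sum_apply, Matrix.smul_apply, smul_eq_mul, productState_diag,
          Complex.re_sum, Complex.re_ofReal_mul, Complex.ofReal_re, Finset.mul_sum]
        rw [Finset.sum_comm]
        exact Finset.sum_congr rfl fun i _ => Finset.sum_congr rfl fun j _ => by ring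

end MultiQubit

theorem theorem4p5 (n : ℕ) (hn : 1 ≤ n) (ρ : MultiQubit.QMatrix n) (hρ : MultiQubit.IsState ρ)
    (a : MultiQubit.Index n → ℝ) (ha : a ∈ MultiQubit.VPos n)
    (c : MultiQubit.Index n → ℂ) (hc : c ∈ MultiQubit.VSa n)
    (hX : MultiQubit.xPart ρ = MultiQubit.X a c)
    (hsep : MultiQubit.IsSeparable ρ) :
    MultiQubit.Delta a ≥ MultiQubit.xDualNorm c := by
  have hdiag : ∀ i, ρ i i = (a i : ℂ) := fun i => by
    simpa [MultiQubit.xPart, MultiQubit.X] using congrFun (congrFun hX i) i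
  -- For `n ≥ 1` the anti-diagonal misses the diagonal, so this entry of `X a c` is `c i`.
  have hanti : ∀ i, ρ i i.flip = c i := fun i => by
    simpa [MultiQubit.xPart, MultiQubit.X, MultiQubit.Index.flip_ne hn i] using
      congrFun (congrFun hX i) i.flip
  -- `sSup ∅ = 0` in `ℝ`, so with `0 ≤ Delta a` no normalized `u` need be exhibited.
  refine Real.sSup_le ?_ (Real.sInf_nonneg ?_)
  · rintro t ⟨u, -, hu1, rfl⟩
    -- The infimum does need a normalized `s`: the constant `2⁻ⁿ` serves.
    refine le_csInf ⟨_, _, fun _ => by positivity, MultiQubit.delta_const n, rfl⟩ ?_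
    rintro t ⟨s, hs, hs1, rfl⟩
    simpa [hdiag, hanti] using hsep.re_pairing_le hs (hu1.trans hs1.symm).le
  · rintro t ⟨s, hs, -, rfl⟩
    exact Finset.sum_nonneg fun i _ => mul_nonneg (hs i) (ha i)
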